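/- Let $\mathcal P_1(\mathbb R)$ be the set of Borel probability measures on $\mathbb R$ with finite first moment. For $\mu,\nu\in\mathcal P_1(\mathbb R)$ write $\mu\preceq_c\nu$ if $\int h\,d\mu\le\int h\,d\nu$ for every convex $h:\mathbb R\to\mathbb R$ of linear growth, let $\Pi(\mu,\nu)$ be the set of probability measures on $\mathbb R\times\mathbb R$ with marginals $\mu$ and $\nu$, and put $\mathcal W_1(\mu,\nu)=\inf_{\pi\in\Pi(\mu,\nu)}\int|x-y|\,\pi(dx,dy)$. Let $\mathcal M(\mu,\nu)$ be the set of $\pi\in\Pi(\mu,\nu)$ whose disintegration $\pi(dx,dy)=\mu(dx)\,\pi^x(dy)$ satisfies $\int y\,\pi^x(dy)=x$ for $\mu$-a.e. $x$. A pair $(\mu,\nu)$ with $\mu\preceq_c\nu$ is called irreducible if for all Borel sets $A,B\subseteq\mathbb R$ with $\mu(A)>0$ and $\nu(B)>0$ there is $\pi\in\mathcal M(\mu,\nu)$ with $\pi(A\times B)>0$. Write $\mathrm{co}(\mathrm{supp}(\nu))$ for the closed convex hull of the support of $\nu$. **Lemma A.1.** Let $\mu,\nu\in\mathcal P_1(\mathbb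 R)$ with $\mu\preceq_c\nu$. Then there is a sequence of pairs $(\mu_n,\nu_n)_{n\in\mathbb N}$ in $\mathcal P_1(\mathbb R)\times\mathcal P_1(\mathbb R)$ such that, for every $n$, $\mu_n\preceq_c\nu_n$, the pair $(\mu_n,\nu_n)$ is irreducible, and - (A1) $\nu_n$ is absolutely continuous with respect to Lebesgue measure; - (A2) $\mathrm{supp}(\mu_n)\subseteq\mathrm{int}(\mathrm{co}(\mathrm{supp}(\nu_n)))$; - (A3) the Lebesgue density of $\nu_n$ is (almost everywhere) bounded away from zero on $\mathrm{co}(\mathrm{supp}(\nu_n))$; and $$\lim_{n\to\infty}\mathcal W_1(\mu_n,\mu)=0=\lim_{n\to\infty}\mathcal W_1(\nu_n,\nu).$$ -/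

import Mathlib

open MeasureTheory ProbabilityTheory Filter Topology
open scoped ENNReal

namespace BassApprox

/-- `μ ∈ 𝒫₁(ℝ)`: a Borel probability measure on `ℝ` with finite first moment. -/
structure IsP1 (μ : Measure ℝ) : Prop where
  isProb : IsProbabilityMeasure μ
  integrable_id : Integrable (fun x : ℝ => x) μ

/-- Convex order on `𝒫₁(ℝ)`: `∫ h dμ ≤ ∫ h dν` for all convex `h : ℝ → ℝ` of linear growth.
For measures in `𝒫₁(ℝ)` such `h` are continuous and integrable. -/
structure ConvexOrder (μ ν : Measure ℝ) : Prop where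
  left_mem : IsP1 μ
  right_mem : IsP1 ν
  integral_le : ∀ h : ℝ → ℝ, ConvexOn ℝ Set.univ h →
    (∃ C : ℝ, ∀ x, |h x| ≤ C * (1 + |x|)) → ∫ x, h x ∂μ ≤ ∫ x, h x ∂ν

/-- `π ∈ Π(μ, ν)`: `π` has first marginal `μ` and second marginal `ν`. -/
structure IsCoupling (π : Measure (ℝ × ℝ)) (μ ν : Measure ℝ) : Prop where
  isProb : IsProbabilityMeasure π
  fst_eq : π.map Prod.fst = μ
  snd_eq : π.map Prod.snd = ν

/-- `π ∈ ℳ(μ, ν)`: a coupling of `μ` and `ν` whose disintegration `π(dx,dy) = μ(dx) κ(x,dy)`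
with respect to `μ` satisfies `mean (κ x) = x` for `μ`-a.e. `x`. (The disintegration is unique up
to `μ`-null sets.) -/
structure IsMartingaleCoupling (π : Measure (ℝ × ℝ)) (μ ν : Measure ℝ) : Prop where
  isCoupling : IsCoupling π μ ν
  mean_eq : ∃ κ : Kernel ℝ ℝ, IsMarkovKernel κ ∧ π = μ ⊗ₘ κ ∧
    ∀ᵐ x ∂μ, Integrable (fun y : ℝ => y) (κ x) ∧ ∫ y, y ∂(κ x) = x

/-- The pair `(μ, ν)` is in convex order and irreducible: any two Borel sets `A`, `B` with
`μ A > 0` and `ν B > 0` are connected by some martingale coupling. -/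
structure Irreducible (μ ν : Measure ℝ) : Prop where
  convexOrder : ConvexOrder μ ν
  connects : ∀ A B : Set ℝ, MeasurableSet A → MeasurableSet B → 0 < μ A → 0 < ν B →
    ∃ π : Measure (ℝ × ℝ), IsMartingaleCoupling π μ ν ∧ 0 < π (A ×ˢ B)

/-- The closed convex hull of the support of `ν`. -/
def coSupp (ν : Measure ℝ) : Set ℝ := closure (convexHull ℝ ν.support)

/-- The regularity assumption on the pair `(μ, ν)`. -/
structure RegularPair (μ ν : Measure ℝ) : Prop where
  /-- `ν` is absolutely continuous with respect to Lebesgue measure. -/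
  absolutelyContinuous : ν ≪ volume
  /-- The support of `μ` lies in the interior of the closed convex hull of the support of `ν`. -/
  support_subset : μ.support ⊆ interior (coSupp ν)
  /-- The Lebesgue density of `ν` is (a.e.) bounded away from zero on that hull. -/
  density_bound : ∃ c : ℝ, 0 < c ∧
    ∀ᵐ x ∂(volume : Measure ℝ), x ∈ coSupp ν → ENNReal.ofReal c ≤ ν.rnDeriv volume x

/-- The `1`-Wasserstein distance, `inf_{π ∈ Π(μ, ν)} ∫ |x - y| π(dx,dy)`, with values
in `[0, ∞]` (finite on `𝒫₁(ℝ)`). -/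
noncomputable def W1 (μ ν : Measure ℝ) : ℝ≥0∞ :=
  ⨅ (π : Measure (ℝ × ℝ)) (_ : IsCoupling π μ ν), ∫⁻ z, ENNReal.ofReal |z.1 - z.2| ∂π

end BassApprox

/-! Fix `ε ≤ 1`. Cut `μ` along the fibres `A i` of a simple function that is `ε`-close to the
identity in `L¹(μ)`. A finite form of Strassen's theorem splits `ν = ∑ N i`, where `N i` has the
mass and first moment of `μ` on `A i`. Next smooth `ν` by a Markov kernel `κ` whose measures all
live on one interval `[-R, R]`, have density at least `c` there, and satisfy mean `κ y = clip K y`.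
Take `ν' = κ ∘ₘ ν = ∑ ρ i` with `ρ i = κ ∘ₘ N i`, and let `μ'` put the mass of `ρ i` at its
barycenter `ξ i`, which lies in `[-K, K] ⊆ (-R, R)`.

Sending `ξ i` to `ρ i` is a martingale coupling, so Jensen gives the convex order. Every `ρ i` of
positive mass dominates a multiple of Lebesgue measure on `[-R, R]`, so this one coupling charges
every product of non-null sets. The same bound for `ν'` gives its regularity. Both Wasserstein
errors are at most `3ε`: `κ` moves mass little, and `ξ i` differs from the value of the simple
function on `A i` only by the errors of discretization and truncation.

The finite Strassen theorem is a separation argument. The moment vectors of partitions of unity form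
a compact convex set, by Banach-Alaoglu. Its support function in direction `(a, b)` is the
`ν`-integral of `max_i (a i + b i * y)`, and the convex order tested on this convex function says
exactly that the target moments satisfy every supporting inequality. -/

namespace BassApprox

/-! ### Cells on which a given member of a finite family is maximal. -/

section Argmax

/-- Turns a separating functional on moment vectors into the coefficients of finitely many affine
functions. -/
theorem exists_pi_coeff {ι : Type*} [Fintype ι] (F : StrongDual ℝ ((ι → ℝ) × (ι → ℝ))) :
    ∃ a b : ι → ℝ, ∀ p q, F (p, q) = ∑ i, (a i * p i + b i * q i) := by
  classical
  refine ⟨fun i => F (fun j => if i = j then 1 else 0, 0),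
    fun i => F (0, fun j => if i = j then 1 else 0), fun p q => ?_⟩
  have h1 : F (p, 0) = ∑ i, F (fun j => if i = j then 1 else 0, 0) * p i := by
    simpa [mul_comm] using LinearMap.pi_apply_eq_sum_univ
      (F.toLinearMap ∘ₗ LinearMap.inl ℝ (ι → ℝ) (ι → ℝ)) p
  have h2 : F (0, q) = ∑ i, F (0, fun j => if i = j then 1 else 0) * q i := by
    simpa [mul_comm] using LinearMap.pi_apply_eq_sum_univ
      (F.toLinearMap ∘ₗ LinearMap.inr ℝ (ι → ℝ) (ι → ℝ)) q
  have : (p, q) = (p, (0 : ι → ℝ)) + ((0 : ι → ℝ), q) := by simp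
  rw [this, map_add, h1, h2, Finset.sum_add_distrib]

variable {α ι : Type*} [LinearOrder ι]

/-- The set of points where `i` is the first index at which the finite family `ℓ` is maximal. -/
def firstArgmax (ℓ : ι → α → ℝ) (i : ι) : Set α :=
  {x | (∀ j, ℓ j x ≤ ℓ i x) ∧ ∀ j, j < i → ℓ j x < ℓ i x}

theorem measurableSet_firstArgmax [MeasurableSpace α] [Finite ι] {ℓ : ι → α → ℝ} (hℓ : ∀ i, Measurable (ℓ i))
    (i : ι) : MeasurableSet (firstArgmax ℓ i) := by
  have : firstArgmax ℓ i =
      (⋂ j, {x | ℓ j x ≤ ℓ i x}) ∩ ⋂ j, ⋂ (_ : j < i), {x | ℓ j x < ℓ i x} := by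
    ext x; simp [firstArgmax]
  rw [this]
  exact (MeasurableSet.iInter fun j => measurableSet_le (hℓ j) (hℓ i)).inter
    (MeasurableSet.iInter fun j => MeasurableSet.iInter fun _ => measurableSet_lt (hℓ j) (hℓ i))

theorem pairwise_disjoint_firstArgmax (ℓ : ι → α → ℝ) :
    Pairwise (Function.onFun Disjoint (firstArgmax ℓ)) := by
  intro i j hij
  refine Set.disjoint_left.2 fun x hi hj => ?_
  rcases lt_or_gt_of_ne hij with h | h
  · exact absurd (hi.1 j) (not_le.2 (hj.2 i h))
  · exact absurd (hj.1 i) (not_le.2 (hi.2 j h))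

theorem iUnion_firstArgmax [Fintype ι] [Nonempty ι] (ℓ : ι → α → ℝ) :
    ⋃ i, firstArgmax ℓ i = Set.univ := by
  refine Set.eq_univ_of_forall fun x => ?_
  obtain ⟨i₀, hi₀⟩ := Finite.exists_max (fun i => ℓ i x)
  let s : Finset ι := Finset.univ.filter fun i => ∀ j, ℓ j x ≤ ℓ i x
  have hs : s.Nonempty := ⟨i₀, by simpa [s] using hi₀⟩
  have hm := s.min'_mem hs
  refine Set.mem_iUnion.2 ⟨s.min' hs, ?_, fun j hj => ?_⟩
  · simpa [s] using hm
  · by_contra hlt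
    push Not at hlt
    have hjs : j ∈ s := by
      simp only [s, Finset.mem_filter, Finset.mem_univ, true_and] at hm ⊢
      exact fun k => (hm k).trans hlt
    exact absurd (s.min'_le j hjs) (not_le.2 hj)

theorem sup'_eq_of_mem_firstArgmax [Fintype ι] [Nonempty ι] {ℓ : ι → α → ℝ} {i : ι} {x : α}
    (hx : x ∈ firstArgmax ℓ i) :
    Finset.univ.sup' Finset.univ_nonempty (fun i => ℓ i x) = ℓ i x :=
  le_antisymm (Finset.sup'_le _ _ fun j _ => hx.1 j)
    (Finset.le_sup' (fun i => ℓ i x) (Finset.mem_univ i))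

end Argmax

/-! ### Moments of partitions of unity, via weak-* compactness and separation. -/

section Partition

variable {α ι : Type*} [MeasurableSpace α] [Fintype ι]
variable (m : Measure α) [IsFiniteMeasure m]

/-- Tuples of functionals on `L²(m)` that represent partitions of unity. -/
def partitionFunctionals (ι : Type*) [Fintype ι] : Set (ι → WeakDual ℝ (Lp ℝ 2 m)) :=
  {φ | (∀ i, φ i ∈ WeakDual.toStrongDual ⁻¹'
        Metric.closedBall (0 : StrongDual ℝ (Lp ℝ 2 m))
          ‖indicatorConstLp (μ := m) 2 MeasurableSet.univ (measure_ne_top _ _) (1 : ℝ)‖) ∧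
      ∀ (A : Set α) (hA : MeasurableSet A),
        (∀ i, 0 ≤ φ i (indicatorConstLp 2 hA (measure_ne_top _ _) (1 : ℝ))) ∧
        ∑ i, φ i (indicatorConstLp 2 hA (measure_ne_top _ _) (1 : ℝ)) = m.real A}

/-- The norm bound puts the set in a product of weak-* compact balls; the other conditions only
involve evaluations at fixed indicators, hence are closed. -/
theorem isCompact_partitionFunctionals : IsCompact (partitionFunctionals m ι) := by
  refine IsCompact.inter_right (isCompact_pi_infinite fun i => ?_) ?_
  · exact WeakDual.isCompact_closedBall _ _
  · have he : ∀ (i : ι) (g : Lp ℝ 2 m),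
        Continuous fun φ : ι → WeakDual ℝ (Lp ℝ 2 m) => φ i g :=
      fun i g => (WeakDual.eval_continuous g).comp (continuous_apply i)
    change IsClosed {φ : ι → WeakDual ℝ (Lp ℝ 2 m) | ∀ (A : Set α) (hA : MeasurableSet A),
      (∀ i, 0 ≤ φ i (indicatorConstLp 2 hA (measure_ne_top _ _) (1 : ℝ))) ∧
      ∑ i, φ i (indicatorConstLp 2 hA (measure_ne_top _ _) (1 : ℝ)) = m.real A}
    simp only [Set.ofPred_forall, Set.ofPred_and]
    refine isClosed_iInter fun A => isClosed_iInter fun hA => IsClosed.inter ?_ ?_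
    · exact isClosed_iInter fun i => isClosed_le continuous_const (he i _)
    · exact isClosed_eq (continuous_finsetSum _ fun i _ => he i _) continuous_const

theorem convex_partitionFunctionals : Convex ℝ (partitionFunctionals m ι) := by
  rintro φ ⟨hφ, hφ'⟩ ψ ⟨hψ, hψ'⟩ s t hs ht hst
  refine ⟨fun i => ?_, fun A hA => ⟨fun i => ?_, ?_⟩⟩
  · exact convex_closedBall (0 : StrongDual ℝ (Lp ℝ 2 m)) _ (hφ i) (hψ i) hs ht hst
  · exact add_nonneg (mul_nonneg hs ((hφ' A hA).1 i)) (mul_nonneg ht ((hψ' A hA).1 i))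
  · change ∑ i, (s * φ i _ + t * ψ i _) = _
    rw [Finset.sum_add_distrib, ← Finset.mul_sum, ← Finset.mul_sum, (hφ' A hA).2, (hψ' A hA).2,
      ← add_mul, hst, one_mul]

theorem indicator_mem_partitionFunctionals {B : ι → Set α} (hB : ∀ i, MeasurableSet (B i))
    (hd : Pairwise (Function.onFun Disjoint B)) (hU : ⋃ i, B i = Set.univ) :
    (fun i => StrongDual.toWeakDual (InnerProductSpace.toDual ℝ (Lp ℝ 2 m)
      (indicatorConstLp 2 (hB i) (measure_ne_top _ _) (1 : ℝ)))) ∈ partitionFunctionals m ι := by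
  have key : ∀ (A : Set α) (hA : MeasurableSet A) (i : ι),
      (StrongDual.toWeakDual (InnerProductSpace.toDual ℝ (Lp ℝ 2 m)
        (indicatorConstLp 2 (hB i) (measure_ne_top _ _) (1 : ℝ))))
        (indicatorConstLp 2 hA (measure_ne_top _ _) (1 : ℝ)) = m.real (A ∩ B i) := by
    intro A hA i
    change inner ℝ (indicatorConstLp 2 (hB i) (measure_ne_top m _) (1 : ℝ)) _ = _
    rw [L2.inner_indicatorConstLp_one, setIntegral_congr_ae (hB i)
      (indicatorConstLp_coeFn.mono fun x hx _ => hx), setIntegral_indicator hA,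
      setIntegral_const, smul_eq_mul, mul_one, Set.inter_comm]
  refine ⟨fun i => ?_, fun A hA => ⟨fun i => ?_, ?_⟩⟩
  · simp only [Set.mem_preimage, mem_closedBall_zero_iff]
    change ‖InnerProductSpace.toDual ℝ (Lp ℝ 2 m) _‖ ≤ _
    rw [LinearIsometryEquiv.norm_map, norm_indicatorConstLp (by simp) (by simp),
      norm_indicatorConstLp (by simp) (by simp)]
    gcongr
    · exact measure_ne_top _ _
    · exact Set.subset_univ _
  · rw [key]; exact measureReal_nonneg
  · simp only [key]
    rw [← measureReal_iUnion_fintype, ← Set.inter_iUnion, hU, Set.inter_univ]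
    · exact fun i j hij => (hd hij).mono Set.inter_subset_right Set.inter_subset_right
    · exact fun i => hA.inter (hB i)

/-- Riesz representation yields `L²` densities; testing them on indicators gives nonnegativity and
total one almost everywhere. -/
theorem exists_partition_of_mem {φ : ι → WeakDual ℝ (Lp ℝ 2 m)}
    (hφ : φ ∈ partitionFunctionals m ι) :
    ∃ f : ι → α → ℝ, (∀ i, Measurable (f i)) ∧
      (∀ i, 0 ≤ᵐ[m] f i) ∧ (∀ᵐ x ∂m, ∑ i, f i x = 1) ∧
      ∀ i (g : Lp ℝ 2 m), φ i g = ∫ x, f i x * g x ∂m := by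
  obtain ⟨-, hφ⟩ := hφ
  let F : ι → Lp ℝ 2 m := fun i =>
    (InnerProductSpace.toDual ℝ (Lp ℝ 2 m)).symm (WeakDual.toStrongDual (φ i))
  have hF : ∀ i g, φ i g = inner ℝ (F i) g := fun i g => by
    simp [F]
  have hFint : ∀ i, Integrable (F i) m := fun i => (Lp.memLp (F i)).integrable (by norm_num)
  have hset : ∀ i (A : Set α) (hA : MeasurableSet A),
      φ i (indicatorConstLp 2 hA (measure_ne_top _ _) (1 : ℝ)) = ∫ x in A, F i x ∂m :=
    fun i A hA => by rw [hF, real_inner_comm, L2.inner_indicatorConstLp_one]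
  have hmeas : ∀ i, AEStronglyMeasurable (F i) m := fun i => (Lp.memLp (F i)).1
  have hae : ∀ i, F i =ᵐ[m] (hmeas i).mk (F i) := fun i => (hmeas i).ae_eq_mk
  refine ⟨fun i => (hmeas i).mk (F i), fun i => (hmeas i).stronglyMeasurable_mk.measurable,
    fun i => ?_, ?_, fun i g => ?_⟩
  · refine EventuallyLE.trans_eq ?_ (hae i)
    refine ae_nonneg_of_forall_setIntegral_nonneg (hFint i) fun s hs _ => ?_
    rw [← hset i s hs]
    exact (hφ s hs).1 i
  · have h1 : (fun x => ∑ i, F i x) =ᵐ[m] fun _ => (1 : ℝ) := by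
      refine Integrable.ae_eq_of_forall_setIntegral_eq _ _
        (integrable_finsetSum _ fun i _ => hFint i) (integrable_const _) fun s hs _ => ?_
      rw [integral_finsetSum _ fun i _ => (hFint i).integrableOn]
      simp only [← hset _ s hs, (hφ s hs).2]
      simp
    filter_upwards [h1, ae_all_iff.2 hae] with x hx hx'
    simpa [← hx'] using hx
  · rw [hF, L2.inner_def]
    refine integral_congr_ae ?_
    filter_upwards [hae i] with x hx
    simp [← hx, mul_comm]

/-- A finite family of prescribed moments is attained by a partition of unity as soon as the
support function inequality holds. -/
theorem exists_partition [LinearOrder ι] [Nonempty ι] {u v : α → ℝ} (hum : Measurable u)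
    (hvm : Measurable v)
    (hu : MemLp u 2 m) (hv : MemLp v 2 m) (P Q : ι → ℝ)
    (h : ∀ a b : ι → ℝ, ∑ i, (a i * P i + b i * Q i) ≤
      ∫ x, Finset.univ.sup' Finset.univ_nonempty (fun i => a i * u x + b i * v x) ∂m) :
    ∃ f : ι → α → ℝ, (∀ i, Measurable (f i)) ∧
      (∀ i, 0 ≤ᵐ[m] f i) ∧ (∀ᵐ x ∂m, ∑ i, f i x = 1) ∧
      (∀ i, ∫ x, f i x * u x ∂m = P i) ∧ ∀ i, ∫ x, f i x * v x ∂m = Q i := by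
  let L : (ι → WeakDual ℝ (Lp ℝ 2 m)) → (ι → ℝ) × (ι → ℝ) :=
    fun φ => (fun i => φ i (hu.toLp u), fun i => φ i (hv.toLp v))
  have hLc : Continuous L :=
    (continuous_pi fun i => (WeakDual.eval_continuous _).comp (continuous_apply i)).prodMk
      (continuous_pi fun i => (WeakDual.eval_continuous _).comp (continuous_apply i))
  have hLl : IsLinearMap ℝ L := ⟨fun φ ψ => rfl, fun c φ => rfl⟩
  have hS : IsClosed (L '' partitionFunctionals m ι) :=
    ((isCompact_partitionFunctionals m).image hLc).isClosed
  have hconv : Convex ℝ (L '' partitionFunctionals m ι) :=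
    (convex_partitionFunctionals m).is_linear_image hLl
  suffices hmem : (P, Q) ∈ L '' partitionFunctionals m ι by
    obtain ⟨φ, hφ, hL⟩ := hmem
    obtain ⟨f, hfm, hf0, hf1, hfφ⟩ := exists_partition_of_mem m hφ
    refine ⟨f, hfm, hf0, hf1, fun i => ?_, fun i => ?_⟩
    · rw [← show φ i (hu.toLp u) = P i from congrFun (congrArg Prod.fst hL) i, hfφ]
      exact integral_congr_ae (hu.coeFn_toLp.mono fun x hx => by simp [hx])
    · rw [← show φ i (hv.toLp v) = Q i from congrFun (congrArg Prod.snd hL) i, hfφ]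
      exact integral_congr_ae (hv.coeFn_toLp.mono fun x hx => by simp [hx])
  by_contra hnot
  -- The contradiction comes from testing the separating functional on the indicators of the argmax
  -- cells, the partition that maximizes it.
  obtain ⟨F, s, hlt, hgt⟩ := geometric_hahn_banach_closed_point hconv hS hnot
  obtain ⟨a, b, hab⟩ := exists_pi_coeff F
  let ℓ : ι → α → ℝ := fun i x => a i * u x + b i * v x
  have hℓm : ∀ i, Measurable (ℓ i) := fun i => (hum.const_mul _).add (hvm.const_mul _)
  have hui : Integrable u m := hu.integrable (by norm_num)
  have hvi : Integrable v m := hv.integrable (by norm_num)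
  have hℓi : ∀ i, Integrable (ℓ i) m := fun i => (hui.const_mul _).add (hvi.const_mul _)
  have hBm := measurableSet_firstArgmax hℓm
  have hBd := pairwise_disjoint_firstArgmax ℓ
  have hBU := iUnion_firstArgmax ℓ
  have hcell : ∀ (g : α → ℝ) (hg : MemLp g 2 m) (i : ι),
      (StrongDual.toWeakDual (InnerProductSpace.toDual ℝ (Lp ℝ 2 m)
        (indicatorConstLp 2 (hBm i) (measure_ne_top _ _) (1 : ℝ)))) (hg.toLp g) =
        ∫ x in firstArgmax ℓ i, g x ∂m := by
    intro g hg i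
    change inner ℝ (indicatorConstLp 2 (hBm i) (measure_ne_top m _) (1 : ℝ)) _ = _
    rw [L2.inner_indicatorConstLp_one]
    exact setIntegral_congr_ae (hBm i) (hg.coeFn_toLp.mono fun x hx _ => hx)
  have h1 := hlt _ ⟨_, indicator_mem_partitionFunctionals m hBm hBd hBU, rfl⟩
  simp only [L, hab, hcell] at h1
  rw [hab] at hgt
  have h2 := h a b
  -- On its own cell each `ℓ i` equals the maximum, so the support function is attained.
  have h3 : ∫ x, Finset.univ.sup' Finset.univ_nonempty (fun i => ℓ i x) ∂m =
      ∑ i, ∫ x in firstArgmax ℓ i, ℓ i x ∂m := by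
    have hcongr : ∀ i, Set.EqOn (ℓ i)
        (fun x => Finset.univ.sup' Finset.univ_nonempty (fun i => ℓ i x)) (firstArgmax ℓ i) :=
      fun i x hx => (sup'_eq_of_mem_firstArgmax hx).symm
    rw [← setIntegral_univ, ← hBU, integral_iUnion_fintype hBm hBd]
    · exact Finset.sum_congr rfl fun i _ => (setIntegral_congr_fun (hBm i) (hcongr i)).symm
    · exact fun i => ((hℓi i).integrableOn).congr_fun (hcongr i) (hBm i)
  have h4 : ∀ i, ∫ x in firstArgmax ℓ i, ℓ i x ∂m =
      a i * ∫ x in firstArgmax ℓ i, u x ∂m + b i * ∫ x in firstArgmax ℓ i, v x ∂m := fun i => by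
    rw [← integral_const_mul, ← integral_const_mul, ← integral_add
      (hui.const_mul _).integrableOn (hvi.const_mul _).integrableOn]
  simp only [h4] at h3
  linarith

end Partition

/-! ### Transport bounds, the martingale property and Jensen's inequality. -/

section Couplings

theorem IsP1.integrable_of_convexOn {ν : Measure ℝ} (hν : IsP1 ν) {h : ℝ → ℝ}
    (hh : ConvexOn ℝ Set.univ h) {C : ℝ} (hC : ∀ x, |h x| ≤ C * (1 + |x|)) :
    Integrable h ν := by
  have := hν.isProb
  have hcont : Continuous h := by
    rw [← continuousOn_univ]
    exact ConvexOn.continuousOn isOpen_univ hh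
  exact (((integrable_const (1 : ℝ)).add hν.integrable_id.abs).const_mul C).mono'
    hcont.aestronglyMeasurable (ae_of_all _ hC)

theorem W1_le_of_isCoupling {π : Measure (ℝ × ℝ)} {μ ν : Measure ℝ} (hc : IsCoupling π μ ν) :
    W1 μ ν ≤ ∫⁻ z, ENNReal.ofReal |z.1 - z.2| ∂π := by
  unfold W1
  exact iInf₂_le π hc

theorem integrable_integral_compProd {α β : Type*} [MeasurableSpace α] [MeasurableSpace β]
    {μ : Measure α} [SFinite μ] {κ : Kernel α β} [IsSFiniteKernel κ] {f : α × β → ℝ}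
    (hf : Integrable f (μ ⊗ₘ κ)) : Integrable (fun x => ∫ y, f (x, y) ∂κ x) μ := by
  simpa using Integrable.integral_compProd (κ := Kernel.const Unit μ)
    (η := Kernel.prodMkLeft Unit κ) (a := ()) hf

theorem W1_le_of_map {μ : Measure ℝ} [IsProbabilityMeasure μ] {T : ℝ → ℝ} (hT : Measurable T) :
    W1 (μ.map T) μ ≤ ∫⁻ x, ENNReal.ofReal |T x - x| ∂μ := by
  have hm : Measurable fun x => (T x, x) := hT.prodMk measurable_id
  have hc : IsCoupling (μ.map fun x => (T x, x)) (μ.map T) μ := by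
    refine ⟨?_, ?_, ?_⟩
    · exact Measure.isProbabilityMeasure_map hm.aemeasurable
    · rw [Measure.map_map measurable_fst hm]; rfl
    · rw [Measure.map_map measurable_snd hm]; exact Measure.map_id
  refine (W1_le_of_isCoupling hc).trans_eq ?_
  rw [lintegral_map (by fun_prop) hm]

/-- Uses the coupling of a point with its image under `κ`, swapped so that the smoothed measure
comes first. -/
theorem W1_comp_le {ν : Measure ℝ} [IsProbabilityMeasure ν] (κ : Kernel ℝ ℝ) [IsMarkovKernel κ] :
    W1 (κ ∘ₘ ν) ν ≤ ∫⁻ y, ∫⁻ w, ENNReal.ofReal |w - y| ∂κ y ∂ν := by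
  have hc : IsCoupling ((ν ⊗ₘ κ).map Prod.swap) (κ ∘ₘ ν) ν := by
    refine ⟨?_, ?_, ?_⟩
    · exact Measure.isProbabilityMeasure_map measurable_swap.aemeasurable
    · rw [Measure.map_map measurable_fst measurable_swap]
      exact Measure.snd_compProd ν κ
    · rw [Measure.map_map measurable_snd measurable_swap]
      exact Measure.fst_compProd ν κ
  refine (W1_le_of_isCoupling hc).trans_eq ?_
  rw [lintegral_map (by fun_prop) measurable_swap, Measure.lintegral_compProd (by fun_prop)]
  rfl

/-- A coupling is a martingale coupling if the increment integrates to zero over all events of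
the first coordinate. -/
theorem IsCoupling.isMartingaleCoupling {π : Measure (ℝ × ℝ)} {μ ν : Measure ℝ}
    (hπ : IsCoupling π μ ν) (hμ : Integrable (fun x : ℝ => x) μ) (hν : Integrable (fun x : ℝ => x) ν)
    (h : ∀ A : Set ℝ, MeasurableSet A →
      ∫ z in A ×ˢ Set.univ, z.2 ∂π = ∫ x in A, x ∂μ) :
    IsMartingaleCoupling π μ ν := by
  have := hπ.isProb
  have hfst : π.fst = μ := hπ.fst_eq
  have hdis : μ ⊗ₘ π.condKernel = π := by rw [← hfst]; exact π.disintegrate π.condKernel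
  have : IsProbabilityMeasure μ := by rw [← hfst]; infer_instance
  have hsnd : Integrable (fun z : ℝ × ℝ => z.2) (μ ⊗ₘ π.condKernel) := by
    rw [hdis]
    exact Integrable.comp_measurable (f := Prod.snd) (g := fun x : ℝ => x)
      (by rw [hπ.snd_eq]; exact hν) measurable_snd
  refine ⟨hπ, π.condKernel, inferInstance, hdis.symm, ?_⟩
  have h1 := (Measure.integrable_compProd_iff hsnd.1).1 hsnd
  have h2 : (fun x => ∫ y, y ∂π.condKernel x) =ᵐ[μ] fun x => x := by
    refine Integrable.ae_eq_of_forall_setIntegral_eq _ _ (integrable_integral_compProd hsnd) hμ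
      fun s hs _ => ?_
    rw [← h s hs]
    conv_rhs => rw [← hdis]
    rw [Measure.setIntegral_compProd hs MeasurableSet.univ hsnd.integrableOn]
    simp
  exact h1.1.and h2

/-- The easy direction of Strassen's theorem: conditional Jensen on almost every fibre, then
integration over `μ`. -/
theorem IsMartingaleCoupling.convexOrder {π : Measure (ℝ × ℝ)} {μ ν : Measure ℝ}
    (hπ : IsMartingaleCoupling π μ ν) (hμ : IsP1 μ) (hν : IsP1 ν) : ConvexOrder μ ν := by
  refine ⟨hμ, hν, fun h hh ⟨C, hC⟩ => ?_⟩
  have := hμ.isProb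
  have := hν.isProb
  obtain ⟨κ, hκ, hπκ, hmean⟩ := hπ.mean_eq
  have hcont : Continuous h := by
    rw [← continuousOn_univ]
    exact ConvexOn.continuousOn isOpen_univ hh
  have hsnd : (μ ⊗ₘ κ).map Prod.snd = ν := by rw [← hπκ]; exact hπ.isCoupling.snd_eq
  have hi : Integrable (fun z : ℝ × ℝ => h z.2) (μ ⊗ₘ κ) :=
    Integrable.comp_measurable (f := Prod.snd) (g := h)
      (by rw [hsnd]; exact hν.integrable_of_convexOn hh hC) measurable_snd
  have hνint : ∫ y, h y ∂ν = ∫ x, ∫ y, h y ∂κ x ∂μ := by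
    rw [← hsnd, integral_map measurable_snd.aemeasurable hcont.aestronglyMeasurable,
      Measure.integral_compProd hi]
  rw [hνint]
  refine integral_mono_ae (hμ.integrable_of_convexOn hh hC) (integrable_integral_compProd hi) ?_
  filter_upwards [hmean] with x hx
  have := ConvexOn.map_integral_le hh hcont.continuousOn isClosed_univ
    (ae_of_all _ fun _ => Set.mem_univ _) hx.1 (IsP1.integrable_of_convexOn ⟨inferInstance, hx.1⟩ hh hC)
  rwa [hx.2] at this

end Couplings

/-! ### Hull of the support and density bound from domination of Lebesgue measure. -/

section Regularity

/-- A measure carried by a nondegenerate interval on which it dominates Lebesgue measure. -/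
theorem coSupp_eq_Icc {ν : Measure ℝ} {R c : ℝ} (hR : 0 < R) (hc : 0 < c)
    (hI : ν (Set.Icc (-R) R)ᶜ = 0)
    (hlow : ∀ B, MeasurableSet B → ENNReal.ofReal c * volume (B ∩ Set.Icc (-R) R) ≤ ν B) :
    coSupp ν = Set.Icc (-R) R := by
  have hsub : ν.support ⊆ Set.Icc (-R) R :=
    Measure.support_subset_of_isClosed isClosed_Icc (mem_ae_iff.2 hI)
  have hsup : Set.Ioo (-R) R ⊆ ν.support := by
    intro x hx
    rw [Measure.mem_support_iff_forall]
    intro U hU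
    obtain ⟨V, hVU, hV, hxV⟩ := mem_nhds_iff.1 (inter_mem hU (isOpen_Ioo.mem_nhds hx))
    refine lt_of_lt_of_le ?_ ((hlow V hV.measurableSet).trans
      (measure_mono (hVU.trans Set.inter_subset_left)))
    have : V ∩ Set.Icc (-R) R = V := Set.inter_eq_left.2
      ((hVU.trans Set.inter_subset_right).trans Set.Ioo_subset_Icc_self)
    rw [this]
    exact ENNReal.mul_pos (by simpa using hc) (hV.measure_pos volume ⟨x, hxV⟩).ne'
  refine subset_antisymm ?_ ?_
  · exact closure_minimal (convexHull_min hsub (convex_Icc _ _)) isClosed_Icc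
  · rw [← closure_Ioo (by linarith : -R ≠ R)]
    exact closure_mono (hsup.trans (subset_convexHull ℝ _))

/-- The lower bound `hlow` serves twice: it identifies the hull as `[-R, R]`, and, compared over all
Borel sets, it bounds the density from below. -/
theorem regularPair_of_bounds {μ ν : Measure ℝ} [IsFiniteMeasure ν] {R c : ℝ} (hR : 0 < R)
    (hc : 0 < c) (hac : ν ≪ volume) (hI : ν (Set.Icc (-R) R)ᶜ = 0)
    (hlow : ∀ B, MeasurableSet B → ENNReal.ofReal c * volume (B ∩ Set.Icc (-R) R) ≤ ν B)
    {K : Set ℝ} (hK : IsClosed K) (hKR : K ⊆ Set.Ioo (-R) R) (hμK : μ Kᶜ = 0) :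
    RegularPair μ ν := by
  have hco := coSupp_eq_Icc hR hc hI hlow
  refine ⟨hac, ?_, c, hc, ?_⟩
  · rw [hco, interior_Icc]
    exact (Measure.support_subset_of_isClosed hK (mem_ae_iff.2 hμK)).trans hKR
  · rw [hco]
    have : (Set.Icc (-R) R).indicator (fun _ => ENNReal.ofReal c) ≤ᵐ[volume]
        ν.rnDeriv volume := by
      refine ae_le_of_forall_setLIntegral_le_of_sigmaFinite
        (measurable_const.indicator measurableSet_Icc) fun s hs _ => ?_
      rw [Measure.setLIntegral_rnDeriv hac, setLIntegral_indicator measurableSet_Icc,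
        setLIntegral_const, Set.inter_comm]
      exact hlow s hs
    filter_upwards [this] with x hx hxI
    simpa [hxI] using hx

end Regularity

/-! ### Strassen's theorem for a finite partition. -/

section Decomposition

variable {ι : Type*} [Fintype ι]

theorem convexOn_sup'_affine [Nonempty ι] (a b : ι → ℝ) :
    ConvexOn ℝ Set.univ
      fun y : ℝ => Finset.univ.sup' Finset.univ_nonempty (fun i => a i + b i * y) := by
  refine ⟨convex_univ, fun x _ y _ s t hs ht hst => Finset.sup'_le _ _ fun i _ => ?_⟩
  have hx := Finset.le_sup' (fun i => a i + b i * x) (Finset.mem_univ i)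
  have hy := Finset.le_sup' (fun i => a i + b i * y) (Finset.mem_univ i)
  simp only [smul_eq_mul]
  calc a i + b i * (s * x + t * y) = s * (a i + b i * x) + t * (a i + b i * y) := by
        linear_combination -(a i) * hst
    _ ≤ _ := add_le_add (mul_le_mul_of_nonneg_left hx hs) (mul_le_mul_of_nonneg_left hy ht)

theorem abs_sup'_affine_le [Nonempty ι] (a b : ι → ℝ) (y : ℝ) :
    |Finset.univ.sup' Finset.univ_nonempty (fun i => a i + b i * y)| ≤
      (∑ i, (|a i| + |b i|)) * (1 + |y|) := by
  obtain ⟨i, -, hi⟩ := Finset.exists_mem_eq_sup' Finset.univ_nonempty (fun i => a i + b i * y)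
  rw [hi]
  have h1 : |a i| + |b i| ≤ ∑ i, (|a i| + |b i|) :=
    Finset.single_le_sum (f := fun i => |a i| + |b i|) (fun j _ => by positivity)
      (Finset.mem_univ i)
  calc |a i + b i * y| ≤ |a i| + |b i| * |y| := by
        rw [← abs_mul]; exact abs_add_le _ _
    _ ≤ (|a i| + |b i|) * (1 + |y|) := by
        nlinarith [abs_nonneg (a i), abs_nonneg (b i), abs_nonneg y,
          mul_nonneg (abs_nonneg (a i)) (abs_nonneg y)]
    _ ≤ _ := mul_le_mul_of_nonneg_right h1 (by positivity)

/-- The support function inequality encoded by the convex order. -/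
theorem ConvexOrder.sum_le_integral_sup' {μ ν : Measure ℝ} (h : ConvexOrder μ ν) [Nonempty ι]
    {A : ι → Set ℝ} (hA : ∀ i, MeasurableSet (A i)) (hd : Pairwise (Function.onFun Disjoint A))
    (hU : ⋃ i, A i = Set.univ) (a b : ι → ℝ) :
    ∑ i, (a i * μ.real (A i) + b i * ∫ x in A i, x ∂μ) ≤
      ∫ y, Finset.univ.sup' Finset.univ_nonempty (fun i => a i + b i * y) ∂ν := by
  have := h.left_mem.isProb
  have hconv := convexOn_sup'_affine a b
  have hgrow := abs_sup'_affine_le a b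
  refine le_trans ?_ (h.integral_le _ hconv ⟨_, hgrow⟩)
  have hint := h.left_mem.integrable_of_convexOn hconv hgrow
  rw [← setIntegral_univ (μ := μ), ← hU, integral_iUnion_fintype hA hd fun i => hint.integrableOn]
  refine Finset.sum_le_sum fun i _ => ?_
  have hid : IntegrableOn (fun x : ℝ => x) (A i) μ := h.left_mem.integrable_id.integrableOn
  have : a i * μ.real (A i) + b i * ∫ x in A i, x ∂μ = ∫ x in A i, (a i + b i * x) ∂μ := by
    rw [integral_add (integrable_const _) (hid.const_mul _), integral_const_mul]
    simp [mul_comm]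
  rw [this]
  refine integral_mono ((integrable_const _).add (hid.const_mul _)) hint.integrableOn fun x => ?_
  exact Finset.le_sup' (fun i => a i + b i * x) (Finset.mem_univ i)

/-- Strassen's theorem for a finite partition: `ν` splits into pieces with the masses and first
moments of the pieces of `μ`. -/
theorem ConvexOrder.exists_decomposition {μ ν : Measure ℝ} (h : ConvexOrder μ ν) [LinearOrder ι]
    [Nonempty ι] {A : ι → Set ℝ} (hA : ∀ i, MeasurableSet (A i))
    (hd : Pairwise (Function.onFun Disjoint A)) (hU : ⋃ i, A i = Set.univ) :
    ∃ N : ι → Measure ℝ, ∑ i, N i = ν ∧ (∀ i, N i Set.univ = μ (A i)) ∧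
      ∀ i, ∫ y, y ∂N i = ∫ x in A i, x ∂μ := by
  have := h.left_mem.isProb
  have := h.right_mem.isProb
  have hpos : ∀ y : ℝ, 0 < 1 + |y| := fun y => by positivity
  have hwm : Measurable fun y : ℝ => ENNReal.ofReal (1 + |y|) := by fun_prop
  -- With only a first moment, `y` need not be in `L²(ν)`. Moving the weight `1 + |y|` into the
  -- measure keeps it finite and replaces `1` and `y` by the bounded functions `u` and `v`.
  set m : Measure ℝ := ν.withDensity fun y => ENNReal.ofReal (1 + |y|) with hm
  have hmfin : IsFiniteMeasure m :=
    isFiniteMeasure_withDensity_ofReal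
      ((integrable_const (1 : ℝ)).add h.right_mem.integrable_id.abs).2
  let u : ℝ → ℝ := fun y => (1 + |y|)⁻¹
  let v : ℝ → ℝ := fun y => y * (1 + |y|)⁻¹
  have hum : Measurable u := by fun_prop
  have hvm : Measurable v := by fun_prop
  have hu1 : ∀ y, ‖u y‖ ≤ 1 := fun y => by
    rw [Real.norm_eq_abs, abs_of_pos (inv_pos.2 (hpos y))]
    exact inv_le_one_of_one_le₀ (by linarith [abs_nonneg y])
  have hv1 : ∀ y, ‖v y‖ ≤ 1 := fun y => by
    rw [Real.norm_eq_abs, abs_mul, abs_of_pos (inv_pos.2 (hpos y)), ← div_eq_mul_inv,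
      div_le_one (hpos y)]
    linarith
  have hu : MemLp u 2 m := MemLp.of_bound hum.aestronglyMeasurable 1 (ae_of_all _ hu1)
  have hv : MemLp v 2 m := MemLp.of_bound hvm.aestronglyMeasurable 1 (ae_of_all _ hv1)
  have hsupp : ∀ a b : ι → ℝ, ∑ i, (a i * μ.real (A i) + b i * ∫ x in A i, x ∂μ) ≤
      ∫ x, Finset.univ.sup' Finset.univ_nonempty (fun i => a i * u x + b i * v x) ∂m := by
    intro a b
    refine (h.sum_le_integral_sup' hA hd hU a b).trans_eq ?_
    rw [hm, integral_withDensity_eq_integral_toReal_smul hwm (by simp)]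
    refine integral_congr_ae (ae_of_all _ fun y => ?_)
    simp only [ENNReal.toReal_ofReal (hpos y).le, smul_eq_mul]
    rw [Finset.mul₀_sup' (hpos y).le]
    congr 1
    funext i
    simp only [u, v]
    field_simp [(hpos y).ne']
  obtain ⟨f, hfm, hf0, hf1, hfu, hfv⟩ := exists_partition m hum hvm hu hv _ _ hsupp
  have hfle : ∀ i, ∀ᵐ x ∂m, ‖f i x‖ ≤ 1 := fun i => by
    filter_upwards [ae_all_iff.2 hf0, hf1] with x h0 h1
    rw [Real.norm_eq_abs, abs_of_nonneg (h0 i), ← h1]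
    exact Finset.single_le_sum (f := fun i => f i x) (fun j _ => h0 j) (Finset.mem_univ i)
  have hfum : ∀ i, Measurable fun x => ENNReal.ofReal (f i x * u x) := fun i =>
    ((hfm i).mul hum).ennreal_ofReal
  refine ⟨fun i => m.withDensity fun x => ENNReal.ofReal (f i x * u x), ?_, fun i => ?_,
    fun i => ?_⟩
  · have h1 : ∑ i, m.withDensity (fun x => ENNReal.ofReal (f i x * u x)) =
        m.withDensity fun x => ENNReal.ofReal (u x) := by
      ext s hs
      rw [Measure.finsetSum_apply, withDensity_apply _ hs]
      simp only [withDensity_apply _ hs]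
      rw [← lintegral_finsetSum _ fun i _ => hfum i]
      refine lintegral_congr_ae (ae_restrict_of_ae ?_)
      filter_upwards [ae_all_iff.2 hf0, hf1] with x h0 h1
      rw [← ENNReal.ofReal_sum_of_nonneg fun i _ =>
        mul_nonneg (h0 i) (inv_pos.2 (hpos x)).le, ← Finset.sum_mul, h1, one_mul]
    rw [h1, hm, ← withDensity_mul _ hwm hum.ennreal_ofReal]
    have : ((fun y : ℝ => ENNReal.ofReal (1 + |y|)) * fun x => ENNReal.ofReal (u x)) = 1 := by
      funext y
      simp only [Pi.mul_apply, Pi.one_apply, u]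
      rw [← ENNReal.ofReal_mul (hpos y).le, mul_inv_cancel₀ (hpos y).ne', ENNReal.ofReal_one]
    rw [this, withDensity_one]
  · rw [withDensity_apply _ MeasurableSet.univ, Measure.restrict_univ,
      ← ofReal_integral_eq_lintegral_ofReal, hfu, ofReal_measureReal]
    · refine (hu.integrable (by norm_num)).bdd_mul (c := 1) (hfm i).aestronglyMeasurable (hfle i)
    · filter_upwards [hf0 i] with x hx
      exact mul_nonneg hx (inv_pos.2 (hpos x)).le
  · rw [← hfv, integral_withDensity_eq_integral_toReal_smul (hfum i) (by simp)]
    refine integral_congr_ae ?_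
    filter_upwards [hf0 i] with x hx
    rw [ENNReal.toReal_ofReal (mul_nonneg hx (inv_pos.2 (hpos x)).le), smul_eq_mul]
    simp only [v]
    ring

end Decomposition

/-! ### The truncating and smoothing kernel. -/

section Smoothing

/-- The projection of `ℝ` onto `[-K, K]`. -/
noncomputable def clip (K y : ℝ) : ℝ := max (-K) (min y K)

@[fun_prop]
theorem measurable_clip (K : ℝ) : Measurable (clip K) := by
  unfold clip; fun_prop

theorem abs_clip_le {K : ℝ} (hK : 0 ≤ K) (y : ℝ) : |clip K y| ≤ K :=
  abs_le.2 ⟨le_max_left _ _, max_le (by linarith) (min_le_right _ _)⟩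

theorem abs_clip_le_abs {K : ℝ} (hK : 0 ≤ K) (y : ℝ) : |clip K y| ≤ |y| := by
  unfold clip
  rcases le_total y K with h | h
  · rw [min_eq_left h]
    rcases le_total (-K) y with h' | h'
    · rw [max_eq_right h']
    · rw [max_eq_left h', abs_neg, abs_of_nonneg hK]
      exact le_trans (by linarith) (neg_le_abs y)
  · rw [min_eq_right h, max_eq_right (by linarith), abs_of_nonneg hK]
    exact h.trans (le_abs_self y)

theorem clip_of_abs_le {K y : ℝ} (h : |y| ≤ K) : clip K y = y := by
  obtain ⟨h1, h2⟩ := abs_le.1 h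
  rw [clip, min_eq_left h2, max_eq_right h1]

theorem setIntegral_Icc_quadratic {a b : ℝ} (hab : a ≤ b) (p q r : ℝ) :
    ∫ w in Set.Icc a b, (p + q * w + r * w ^ 2) =
      p * (b - a) + q * (b ^ 2 - a ^ 2) / 2 + r * (b ^ 3 - a ^ 3) / 3 := by
  rw [integral_Icc_eq_integral_Ioc, ← intervalIntegral.integral_of_le hab,
    intervalIntegral.integral_eq_sub_of_hasDerivAt
      (f := fun w => p * w + q * w ^ 2 / 2 + r * w ^ 3 / 3)]
  · ring
  · intro w _
    have h1 := (hasDerivAt_id' w).const_mul p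
    have h2 := ((hasDerivAt_pow 2 w).const_mul q).div_const 2
    have h3 := ((hasDerivAt_pow 3 w).const_mul r).div_const 3
    refine ((h1.add h2).add h3).congr_deriv ?_
    push_cast
    ring
  · exact Continuous.intervalIntegrable (by fun_prop) _ _

/-- The uniform density on `[z - ε, z + ε]`. -/
noncomputable def bumpDensity (ε z w : ℝ) : ℝ := if |w - z| ≤ ε then (2 * ε)⁻¹ else 0

/-- The affine probability density on `[-R, R]` with mean `z`. -/
noncomputable def affineDensity (R z w : ℝ) : ℝ := (2 * R)⁻¹ * (1 + 3 * z * w / R ^ 2)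

theorem setIntegral_mul_bumpDensity {ε R z : ℝ} (hε : 0 < ε) (hR : |z| + ε ≤ R) (p q : ℝ) :
    ∫ w in Set.Icc (-R) R, (p + q * w) * bumpDensity ε z w = p + q * z := by
  have h1 : (fun w => (p + q * w) * bumpDensity ε z w) =
      (Set.Icc (z - ε) (z + ε)).indicator
        fun w => (2 * ε)⁻¹ * p + (2 * ε)⁻¹ * q * w + 0 * w ^ 2 := by
    funext w
    by_cases hw : |w - z| ≤ ε
    · have : w ∈ Set.Icc (z - ε) (z + ε) := by
        rw [abs_le] at hw; constructor <;> linarith [hw.1, hw.2]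
      rw [Set.indicator_of_mem this, bumpDensity, if_pos hw]; ring
    · have : w ∉ Set.Icc (z - ε) (z + ε) := fun h => hw <| by
        rw [abs_le]; constructor <;> linarith [h.1, h.2]
      rw [Set.indicator_of_notMem this, bumpDensity, if_neg hw, mul_zero]
  have h2 : Set.Icc (-R) R ∩ Set.Icc (z - ε) (z + ε) = Set.Icc (z - ε) (z + ε) :=
    Set.inter_eq_right.2 (Set.Icc_subset_Icc (by linarith [neg_abs_le z])
      (by linarith [le_abs_self z]))
  rw [h1, setIntegral_indicator measurableSet_Icc, h2,
    setIntegral_Icc_quadratic (by linarith)]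
  field_simp
  ring

theorem setIntegral_mul_affineDensity {R : ℝ} (hR : 0 < R) (z p q : ℝ) :
    ∫ w in Set.Icc (-R) R, (p + q * w) * affineDensity R z w = p + q * z := by
  have h1 : (fun w => (p + q * w) * affineDensity R z w) =
      fun w => (2 * R)⁻¹ * p + (2 * R)⁻¹ * (q + 3 * z * p / R ^ 2) * w
        + (2 * R)⁻¹ * (3 * z * q / R ^ 2) * w ^ 2 := by
    funext w
    rw [affineDensity]; ring
  rw [h1, setIntegral_Icc_quadratic (by linarith)]
  field_simp
  ring

theorem bumpDensity_nonneg {ε : ℝ} (hε : 0 < ε) (z w : ℝ) : 0 ≤ bumpDensity ε z w := by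
  unfold bumpDensity
  split_ifs <;> positivity

theorem measurable_bumpDensity (ε : ℝ) :
    Measurable (Function.uncurry (bumpDensity ε)) := by
  unfold bumpDensity
  refine Measurable.ite ?_ measurable_const measurable_const
  exact measurableSet_le (by fun_prop) measurable_const

theorem measurable_affineDensity (R : ℝ) :
    Measurable (Function.uncurry (affineDensity R)) := by
  unfold affineDensity Function.uncurry
  fun_prop

/-- Since `|z| ≤ R / 4` and `|w| ≤ R`, the tilt `3zw / R²` is at least `-3/4`, leaving a quarter of
the uniform density. -/
theorem le_affineDensity {R K z w : ℝ} (hR : 0 < R) (hKR : 4 * K ≤ R) (hz : |z| ≤ K)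
    (hw : w ∈ Set.Icc (-R) R) : (8 * R)⁻¹ ≤ affineDensity R z w := by
  have h1 : |z * w| ≤ R / 4 * R := by
    rw [abs_mul]
    exact mul_le_mul (by linarith) (abs_le.2 hw) (abs_nonneg _) (by positivity)
  have h2 : -(3 / 4) ≤ 3 * z * w / R ^ 2 := by
    rw [le_div_iff₀ (by positivity)]
    nlinarith [(abs_le.1 h1).1]
  have h3 : (8 * R)⁻¹ = (2 * R)⁻¹ * (1 / 4) := by
    rw [mul_inv, mul_inv]; ring
  rw [affineDensity, h3]
  gcongr
  linarith

theorem integrableOn_mul_bumpDensity {ε R : ℝ} (hε : 0 < ε) (z : ℝ) {g : ℝ → ℝ}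
    (hg : Continuous g) :
    IntegrableOn (fun w => g w * bumpDensity ε z w) (Set.Icc (-R) R) := by
  refine Integrable.mul_bdd (c := (2 * ε)⁻¹) hg.integrableOn_Icc
    ((measurable_bumpDensity ε).comp measurable_prodMk_left).aestronglyMeasurable
    (ae_of_all _ fun w => ?_)
  rw [Real.norm_eq_abs, abs_of_nonneg (bumpDensity_nonneg hε z w), bumpDensity]
  split_ifs
  · rfl
  · positivity

theorem integrableOn_mul_affineDensity (R z : ℝ) {g : ℝ → ℝ} (hg : Continuous g) :
    IntegrableOn (fun w => g w * affineDensity R z w) (Set.Icc (-R) R) := by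
  refine Continuous.integrableOn_Icc (hg.mul ?_)
  unfold affineDensity
  fun_prop

/-- A Markov kernel with bounded densities on a fixed interval, bounded away from zero there, that
moves every point of `[-K, K]` by little in mean and preserves means on `[-K, K]`. -/
theorem exists_smoothing_kernel {K ε : ℝ} (hK : 0 ≤ K) (hε : 0 < ε) (hε1 : ε ≤ 1) :
    ∃ (κ : Kernel ℝ ℝ) (R c : ℝ), IsMarkovKernel κ ∧ K < R ∧ 0 < c ∧
      (∀ y, κ y ≪ volume) ∧ (∀ y, κ y (Set.Icc (-R) R)ᶜ = 0) ∧
      (∀ y B, MeasurableSet B → ENNReal.ofReal c * volume (B ∩ Set.Icc (-R) R) ≤ κ y B) ∧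
      (∀ y, ∫ w, w ∂κ y = clip K y) ∧
      ∀ y, ∫⁻ w, ENNReal.ofReal |w - y| ∂κ y ≤ ENNReal.ofReal (|clip K y - y| + 2 * ε) := by
  -- The factor `4` keeps the tilted affine density positive; the extra `1 ≥ ε` makes room for the
  -- bump.
  set R : ℝ := 4 * (K + 1) with hRdef
  have hR : 0 < R := by positivity
  -- The affine part can move mass by up to `2R` from `clip K y`; this weight makes its cost at most
  -- `ε`. The bump supplies closeness, the affine part the lower bound.
  set δ : ℝ := ε / (2 * R) with hδ
  have hδ0 : 0 < δ := by positivity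
  have hδ1 : 0 ≤ 1 - δ := by
    rw [sub_nonneg, hδ, div_le_one (by positivity)]; linarith
  have hδR : δ * (2 * R) = ε := by rw [hδ]; field_simp
  let D : ℝ → ℝ → ℝ := fun y w =>
    (1 - δ) * bumpDensity ε (clip K y) w + δ * affineDensity R (clip K y) w
  have hDm : Measurable (Function.uncurry D) := by
    have h : Measurable fun p : ℝ × ℝ => (clip K p.1, p.2) := by fun_prop
    exact (((measurable_bumpDensity ε).comp h).const_mul _).add
      (((measurable_affineDensity R).comp h).const_mul _)
  have hz : ∀ y, |clip K y| ≤ K := abs_clip_le hK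
  have hDlow : ∀ y, ∀ w ∈ Set.Icc (-R) R, δ * (8 * R)⁻¹ ≤ D y w := fun y w hw => by
    have h1 := le_affineDensity hR (by linarith : 4 * K ≤ R) (hz y) hw
    have h2 := bumpDensity_nonneg hε (clip K y) w
    have := mul_le_mul_of_nonneg_left h1 hδ0.le
    have := mul_nonneg hδ1 h2
    simp only [D]; linarith
  have hc : 0 < δ * (8 * R)⁻¹ := by positivity
  have hDint : ∀ y p q, ∫ w in Set.Icc (-R) R, (p + q * w) * D y w = p + q * clip K y := by
    intro y p q
    have hg : Continuous fun w : ℝ => p + q * w := by fun_prop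
    have h1 : (fun w => (p + q * w) * D y w) = fun w =>
        (1 - δ) * ((p + q * w) * bumpDensity ε (clip K y) w) +
          δ * ((p + q * w) * affineDensity R (clip K y) w) := by
      funext w; simp only [D]; ring
    rw [h1, integral_add ((integrableOn_mul_bumpDensity hε _ hg).const_mul _)
      ((integrableOn_mul_affineDensity R _ hg).const_mul _), integral_const_mul,
      integral_const_mul, setIntegral_mul_bumpDensity hε (by linarith [hz y]),
      setIntegral_mul_affineDensity hR]
    ring
  have hDi : ∀ y {g : ℝ → ℝ}, Continuous g →
      IntegrableOn (fun w => g w * D y w) (Set.Icc (-R) R) := by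
    intro y g hg
    refine (((integrableOn_mul_bumpDensity hε (clip K y) hg).const_mul (1 - δ)).add
      ((integrableOn_mul_affineDensity R (clip K y) hg).const_mul δ)).congr
        (ae_of_all _ fun w => ?_)
    simp only [D, Pi.add_apply]; ring
  have hDI : ∀ y, ∀ᵐ w ∂volume.restrict (Set.Icc (-R) R), 0 ≤ D y w := fun y =>
    (ae_restrict_mem measurableSet_Icc).mono fun w hw => hc.le.trans (hDlow y w hw)
  let κ : Kernel ℝ ℝ := Kernel.withDensity
    (Kernel.const ℝ (volume.restrict (Set.Icc (-R) R))) fun y w => ENNReal.ofReal (D y w)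
  have hκ : ∀ y, κ y = (volume.restrict (Set.Icc (-R) R)).withDensity
      fun w => ENNReal.ofReal (D y w) := fun y => by
    rw [Kernel.withDensity_apply _ (hDm.ennreal_ofReal), Kernel.const_apply]
  have hDmy : ∀ y, Measurable (D y) := fun y => hDm.comp measurable_prodMk_left
  refine ⟨κ, R, δ * (8 * R)⁻¹, ⟨fun y => ⟨?_⟩⟩, by linarith, hc, fun y => ?_, fun y => ?_,
    fun y B hB => ?_, fun y => ?_, fun y => ?_⟩
  · rw [hκ, withDensity_apply _ MeasurableSet.univ, Measure.restrict_univ,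
      ← ofReal_integral_eq_lintegral_ofReal _ (hDI y)]
    · have := hDint y 1 0
      simp only [zero_mul, add_zero, one_mul] at this
      rw [this, ENNReal.ofReal_one]
    · simpa [IntegrableOn] using hDi y (continuous_const (y := (1 : ℝ)))
  · rw [hκ]
    exact (withDensity_absolutelyContinuous _ _).trans Measure.absolutelyContinuous_restrict
  · rw [hκ]
    refine withDensity_absolutelyContinuous _ _ ?_
    rw [Measure.restrict_apply measurableSet_Icc.compl, Set.compl_inter_self, measure_empty]
  · rw [hκ, withDensity_apply _ hB, Measure.restrict_restrict hB, ← setLIntegral_const]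
    exact setLIntegral_mono' (hB.inter measurableSet_Icc) fun w hw =>
      ENNReal.ofReal_le_ofReal (hDlow y w hw.2)
  · rw [hκ, integral_withDensity_eq_integral_toReal_smul (hDmy y).ennreal_ofReal (by simp)]
    have := hDint y 0 1
    simp only [zero_add, one_mul] at this
    rw [← this]
    refine integral_congr_ae ((hDI y).mono fun w hw => ?_)
    simp only [ENNReal.toReal_ofReal hw, smul_eq_mul]
    ring
  · rw [hκ, lintegral_withDensity_eq_lintegral_mul _ (hDmy y).ennreal_ofReal (by fun_prop)]
    have hg : Continuous fun w => |w - y| := by fun_prop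
    have h1 : ∫⁻ w in Set.Icc (-R) R, ((fun w => ENNReal.ofReal (D y w)) *
        fun w => ENNReal.ofReal |w - y|) w =
        ∫⁻ w in Set.Icc (-R) R, ENNReal.ofReal (|w - y| * D y w) := by
      refine lintegral_congr fun w => ?_
      rw [ENNReal.ofReal_mul (abs_nonneg _), mul_comm]; rfl
    rw [h1, ← ofReal_integral_eq_lintegral_ofReal (hDi y hg)
      ((hDI y).mono fun w hw => mul_nonneg (abs_nonneg _) hw)]
    refine ENNReal.ofReal_le_ofReal ?_
    have hb := integrableOn_mul_bumpDensity (R := R) hε (clip K y)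
      (continuous_const (y := |clip K y - y| + ε))
    have ha := integrableOn_mul_affineDensity R (clip K y)
      (continuous_const (y := |clip K y - y| + 2 * R))
    have h2 : ∫ w in Set.Icc (-R) R, |w - y| * D y w ≤ ∫ w in Set.Icc (-R) R,
        ((1 - δ) * ((|clip K y - y| + ε) * bumpDensity ε (clip K y) w) +
          δ * ((|clip K y - y| + 2 * R) * affineDensity R (clip K y) w)) := by
      refine setIntegral_mono_on (hDi y hg) ((hb.const_mul _).add (ha.const_mul _))
        measurableSet_Icc fun w hw => ?_
      have h3 : |w - y| ≤ |clip K y - y| + |w - clip K y| := by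
        rw [add_comm]; exact abs_sub_le _ _ _
      have h4 : |w - clip K y| ≤ 2 * R := by
        have := abs_le.1 (hz y)
        exact abs_le.2 ⟨by linarith [hw.1, hw.2, this.1, this.2],
          by linarith [hw.1, hw.2, this.1, this.2]⟩
      have h5 : |w - y| * bumpDensity ε (clip K y) w ≤
          (|clip K y - y| + ε) * bumpDensity ε (clip K y) w := by
        unfold bumpDensity
        split_ifs with hif
        · gcongr; linarith
        · simp
      have h6 : 0 ≤ affineDensity R (clip K y) w :=
        le_trans (by positivity) (le_affineDensity hR (by linarith : 4 * K ≤ R) (hz y) hw)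
      have h7 : |w - y| * affineDensity R (clip K y) w ≤
          (|clip K y - y| + 2 * R) * affineDensity R (clip K y) w :=
        mul_le_mul_of_nonneg_right (by linarith) h6
      have := mul_le_mul_of_nonneg_left h5 hδ1
      have := mul_le_mul_of_nonneg_left h7 hδ0.le
      simp only [D]
      linarith
    refine h2.trans ?_
    rw [integral_add (hb.const_mul _) (ha.const_mul _), integral_const_mul (1 - δ),
      integral_const_mul δ]
    have e1 := setIntegral_mul_bumpDensity hε (by linarith [hz y] : |clip K y| + ε ≤ R)
      (|clip K y - y| + ε) 0
    have e2 := setIntegral_mul_affineDensity hR (clip K y) (|clip K y - y| + 2 * R) 0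
    simp only [zero_mul, add_zero] at e1 e2
    rw [e1, e2]
    -- The sum is `|clip K y - y| + (1 - δ) * ε + δ * 2R`, and `δ * 2R = ε`.
    nlinarith [mul_pos hδ0 hε]

end Smoothing

/-! ### Martingale couplings from finitely many pieces with known barycenters. -/

section FiniteMixture

variable {ι : Type*} [Fintype ι]

/-- If each piece `ρ i` has barycenter `ξ i`, then sending the mass of `ρ i` from `ξ i` to `ρ i` is
a martingale coupling. -/
theorem isMartingaleCoupling_sum_map (ξ : ι → ℝ) (ρ : ι → Measure ℝ) [∀ i, IsFiniteMeasure (ρ i)]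
    (hmass : ∑ i, ρ i Set.univ = 1) (hint : ∀ i, Integrable (fun w : ℝ => w) (ρ i))
    (hbar : ∀ i, ∫ w, w ∂ρ i = (ρ i).real Set.univ * ξ i) :
    IsMartingaleCoupling (∑ i, (ρ i).map (Prod.mk (ξ i)))
      (∑ i, ρ i Set.univ • Measure.dirac (ξ i)) (∑ i, ρ i) := by
  classical
  have hcoup : IsCoupling (∑ i, (ρ i).map (Prod.mk (ξ i)))
      (∑ i, ρ i Set.univ • Measure.dirac (ξ i)) (∑ i, ρ i) := by
    refine ⟨⟨?_⟩, ?_, ?_⟩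
    · rw [Measure.finsetSum_apply, ← hmass]
      exact Finset.sum_congr rfl fun i _ => by
        rw [Measure.map_apply measurable_prodMk_left MeasurableSet.univ, Set.preimage_univ]
    · ext s hs
      rw [Measure.map_apply measurable_fst hs, Measure.finsetSum_apply, Measure.finsetSum_apply]
      refine Finset.sum_congr rfl fun i _ => ?_
      rw [Measure.map_apply measurable_prodMk_left (measurable_fst hs), Measure.smul_apply,
        Measure.dirac_apply' _ hs]
      by_cases hi : ξ i ∈ s <;> simp [hi, Set.preimage]
    · ext s hs
      rw [Measure.map_apply measurable_snd hs, Measure.finsetSum_apply, Measure.finsetSum_apply]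
      refine Finset.sum_congr rfl fun i _ => ?_
      rw [Measure.map_apply measurable_prodMk_left (measurable_snd hs)]
      rfl
  refine hcoup.isMartingaleCoupling ?_ ?_ fun A hA => ?_
  · exact integrable_finsetSum_measure.2 fun i _ =>
      (integrable_dirac (by simp)).smul_measure (measure_ne_top _ _)
  · exact integrable_finsetSum_measure.2 fun i _ => hint i
  · rw [← integral_indicator (hA.prod MeasurableSet.univ), ← integral_indicator hA,
      integral_finsetSum_measure, integral_finsetSum_measure]
    · refine Finset.sum_congr rfl fun i _ => ?_
      rw [integral_map measurable_prodMk_left.aemeasurable, integral_smul_measure, integral_dirac]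
      · by_cases hi : ξ i ∈ A
        · simp only [Set.indicator, Set.mem_prod, hi, Set.mem_univ, and_self, if_true, hbar]
          rfl
        · simp [Set.indicator, hi]
      · exact (measurable_snd.indicator (hA.prod MeasurableSet.univ)).aestronglyMeasurable
    · exact fun i _ => (integrable_dirac (by simp)).smul_measure (measure_ne_top _ _)
    · intro i _
      refine Integrable.indicator ?_ (hA.prod MeasurableSet.univ)
      rw [integrable_map_measure measurable_snd.aestronglyMeasurable
        measurable_prodMk_left.aemeasurable]
      exact hint i

end FiniteMixture

/-! ### Bounds on a kernel that pass to its mixtures. -/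

section KernelComp

theorem integrable_id_of_compl_Icc {ρ : Measure ℝ} [IsFiniteMeasure ρ] {R : ℝ}
    (h : ρ (Set.Icc (-R) R)ᶜ = 0) : Integrable (fun w : ℝ => w) ρ := by
  refine Integrable.of_bound measurable_id.aestronglyMeasurable R ?_
  filter_upwards [mem_ae_iff.2 h] with w hw
  exact abs_le.2 hw

theorem comp_apply_eq_zero {κ : Kernel ℝ ℝ} {B : Set ℝ} (hB : MeasurableSet B)
    (h : ∀ y, κ y B = 0) (ρ : Measure ℝ) : (κ ∘ₘ ρ) B = 0 := by
  rw [Measure.bind_apply hB κ.aemeasurable]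
  simp [h]

theorem mul_le_comp_apply {κ : Kernel ℝ ℝ} {B : Set ℝ} (hB : MeasurableSet B) {r : ℝ≥0∞}
    (h : ∀ y, r ≤ κ y B) (ρ : Measure ℝ) : r * ρ Set.univ ≤ (κ ∘ₘ ρ) B := by
  rw [Measure.bind_apply hB κ.aemeasurable, ← lintegral_const]
  exact lintegral_mono h

theorem comp_absolutelyContinuous {κ : Kernel ℝ ℝ} {v : Measure ℝ} (h : ∀ y, κ y ≪ v)
    (ρ : Measure ℝ) : κ ∘ₘ ρ ≪ v :=
  Measure.AbsolutelyContinuous.mk fun _ hs h0 => comp_apply_eq_zero hs (fun y => h y h0) ρ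

theorem sum_comp {ι : Type*} [Fintype ι] (κ : Kernel ℝ ℝ) (N : ι → Measure ℝ) :
    ∑ i, κ ∘ₘ N i = κ ∘ₘ ∑ i, N i := by
  ext s hs
  rw [Measure.finsetSum_apply, Measure.bind_apply hs κ.aemeasurable, lintegral_finsetSum_measure]
  exact Finset.sum_congr rfl fun i _ => Measure.bind_apply hs κ.aemeasurable

theorem integral_id_comp {κ : Kernel ℝ ℝ} [IsMarkovKernel κ] {ρ : Measure ℝ} [IsFiniteMeasure ρ]
    (h : Integrable (fun w : ℝ => w) (κ ∘ₘ ρ)) :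
    ∫ w, w ∂(κ ∘ₘ ρ) = ∫ y, ∫ w, w ∂κ y ∂ρ := by
  rw [← Measure.snd_compProd, Measure.snd] at h ⊢
  rw [integral_map measurable_snd.aemeasurable h.aestronglyMeasurable]
  exact Measure.integral_compProd (h.comp_measurable measurable_snd)

end KernelComp

/-! ### Construction of the approximating pair and error estimates. -/

section Approximation

theorem IsP1.exists_clip {ν : Measure ℝ} (hν : IsP1 ν) {ε : ℝ} (hε : 0 < ε) :
    ∃ K : ℝ, 0 ≤ K ∧ ∫ y, |clip K y - y| ∂ν ≤ ε := by
  have := hν.isProb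
  have hlim : Tendsto (fun n : ℕ => ∫ y, |clip n y - y| ∂ν) atTop (𝓝 (∫ _, (0 : ℝ) ∂ν)) := by
    refine tendsto_integral_of_dominated_convergence (fun y => 2 * |y|)
      (fun n => Measurable.aestronglyMeasurable (by fun_prop)) (hν.integrable_id.abs.const_mul 2)
      (fun n => ae_of_all _ fun y => ?_) (ae_of_all _ fun y => ?_)
    · rw [Real.norm_eq_abs, abs_abs]
      have := abs_clip_le_abs (Nat.cast_nonneg (α := ℝ) n) y
      have := abs_sub (clip n y) y
      linarith
    · refine tendsto_const_nhds.congr' ?_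
      filter_upwards [eventually_ge_atTop ⌈|y|⌉₊] with n hn
      rw [clip_of_abs_le (Nat.ceil_le.1 hn), sub_self, abs_zero]
  rw [integral_zero] at hlim
  obtain ⟨n, hn⟩ := (hlim.eventually (ge_mem_nhds hε)).exists
  exact ⟨n, Nat.cast_nonneg n, hn⟩

theorem IsP1.exists_simpleFunc {μ : Measure ℝ} (hμ : IsP1 μ) {ε : ℝ} (hε : 0 < ε) :
    ∃ g : SimpleFunc ℝ ℝ, ∫ x, |x - g x| ∂μ ≤ ε := by
  have := hμ.isProb
  obtain ⟨g, hg, -⟩ := (memLp_one_iff_integrable.2 hμ.integrable_id).exists_simpleFunc_eLpNorm_sub_lt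
    ENNReal.one_ne_top (ε := ENNReal.ofReal ε) (by simpa using hε)
  refine ⟨g, ?_⟩
  rw [eLpNorm_one_eq_lintegral_enorm] at hg
  have h := integral_norm_eq_lintegral_enorm (μ := μ) (f := (fun x : ℝ => x) - ⇑g)
    (measurable_id.sub g.measurable).aestronglyMeasurable
  change ∫ x, |x - g x| ∂μ = _ at h
  rw [h]
  exact ENNReal.toReal_le_of_le_ofReal hε.le hg.le

theorem ConvexOrder.exists_regular_approx {μ ν : Measure ℝ} (h : ConvexOrder μ ν) {ε : ℝ}
    (hε : 0 < ε) (hε1 : ε ≤ 1) :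
    ∃ μ' ν' : Measure ℝ, IsP1 μ' ∧ IsP1 ν' ∧ Irreducible μ' ν' ∧ RegularPair μ' ν' ∧
      W1 μ' μ ≤ ENNReal.ofReal (3 * ε) ∧ W1 ν' ν ≤ ENNReal.ofReal (3 * ε) := by
  classical
  have := h.left_mem.isProb
  have := h.right_mem.isProb
  have hμid := h.left_mem.integrable_id
  have hνid := h.right_mem.integrable_id
  obtain ⟨K, hK0, hK⟩ := h.right_mem.exists_clip hε
  obtain ⟨g, hg⟩ := h.left_mem.exists_simpleFunc hε
  obtain ⟨κ, R, c, hκ, hKR, hc, hκac, hκI, hκlow, hκmean, hκdist⟩ :=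
    exists_smoothing_kernel hK0 hε hε1
  have hR : 0 < R := hK0.trans_lt hKR
  have : Nonempty g.range := ⟨⟨g 0, g.mem_range_self 0⟩⟩
  let A : g.range → Set ℝ := fun i => g ⁻¹' {(i : ℝ)}
  have hA : ∀ i, MeasurableSet (A i) := fun i => g.measurableSet_fiber _
  have hAd : Pairwise (Function.onFun Disjoint A) := fun i j hij =>
    Set.disjoint_left.2 fun x hi hj => hij (Subtype.ext (hi.symm.trans hj))
  have hAU : ⋃ i, A i = Set.univ :=
    Set.eq_univ_of_forall fun x => Set.mem_iUnion.2 ⟨⟨g x, g.mem_range_self x⟩, rfl⟩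
  obtain ⟨N, hNsum, hNmass, hNmean⟩ := h.exists_decomposition hA hAd hAU
  have hNfin : ∀ i, IsFiniteMeasure (N i) := fun i => ⟨by rw [hNmass]; exact measure_lt_top _ _⟩
  have hNle : ∀ i, N i ≤ ν := fun i => by
    rw [← hNsum]
    exact Finset.single_le_sum (f := N) (fun j _ => Measure.zero_le _) (Finset.mem_univ i)
  have hNreal : ∀ i, (N i).real Set.univ = μ.real (A i) := fun i => by
    rw [measureReal_def, hNmass, measureReal_def]
  have hclip : ∀ {ρ : Measure ℝ} [IsFiniteMeasure ρ], Integrable (clip K) ρ := fun {ρ} _ =>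
    Integrable.of_bound (measurable_clip K).aestronglyMeasurable K (ae_of_all _ (abs_clip_le hK0))
  -- The barycenter of `κ ∘ₘ N i`, because `κ y` has mean `clip K y`. For null cells the convention
  -- `0⁻¹ = 0` gives `0`, which still lies in `[-K, K]`.
  let ξ : g.range → ℝ := fun i => (μ.real (A i))⁻¹ * ∫ y, clip K y ∂N i
  have hξ : ∀ i, ∫ y, clip K y ∂N i = μ.real (A i) * ξ i := fun i => by
    by_cases hp : μ.real (A i) = 0
    · have : N i = 0 := by
        rw [← Measure.measure_univ_eq_zero, hNmass, ← measureReal_eq_zero_iff, hp]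
      simp [hp, this]
    · simp only [ξ]; rw [mul_inv_cancel_left₀ hp]
  have hξK : ∀ i, |ξ i| ≤ K := fun i => by
    have h1 : |∫ y, clip K y ∂N i| ≤ K * μ.real (A i) := by
      rw [← hNreal]
      exact norm_integral_le_of_norm_le_const (f := clip K) (ae_of_all _ (abs_clip_le hK0))
    by_cases hp : μ.real (A i) = 0
    · simpa [ξ, hp] using hK0
    · have hp' : 0 < μ.real (A i) := lt_of_le_of_ne measureReal_nonneg (Ne.symm hp)
      rw [hξ, abs_mul, abs_of_pos hp', mul_comm] at h1
      exact le_of_mul_le_mul_right h1 hp'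
  let ρ : g.range → Measure ℝ := fun i => κ ∘ₘ N i
  have hρfin : ∀ i, IsFiniteMeasure (ρ i) := fun i => inferInstance
  have hρmass : ∀ i, ρ i Set.univ = μ (A i) := fun i => by
    simp only [ρ]
    rw [Measure.bind_apply MeasurableSet.univ κ.aemeasurable]
    simp [hNmass]
  have hρI : ∀ i, ρ i (Set.Icc (-R) R)ᶜ = 0 := fun i =>
    comp_apply_eq_zero measurableSet_Icc.compl hκI _
  have hρint : ∀ i, Integrable (fun w : ℝ => w) (ρ i) := fun i => integrable_id_of_compl_Icc (hρI i)
  have hρsum : ∑ i, ρ i = κ ∘ₘ ν := by rw [← hNsum]; exact sum_comp κ N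
  have hmass : ∑ i, ρ i Set.univ = 1 := by
    rw [← Measure.finsetSum_apply, hρsum, measure_univ]
  have hρbar : ∀ i, ∫ w, w ∂ρ i = (ρ i).real Set.univ * ξ i := fun i => by
    rw [measureReal_def, hρmass, ← measureReal_def, ← hξ]
    exact (integral_id_comp (hρint i)).trans (by simp only [hκmean])
  have hmart := isMartingaleCoupling_sum_map ξ ρ hmass hρint hρbar
  -- Realizes `μ'` as an image of `μ`, so that `W1` can be bounded through the map `X`.
  let X : ℝ → ℝ := fun x => ξ ⟨g x, g.mem_range_self x⟩
  have hXA : ∀ i, ∀ x ∈ A i, X x = ξ i := fun i x hx => congrArg ξ (Subtype.ext hx)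
  have hXm : Measurable X := by
    have : X = g.map fun r => if hr : r ∈ g.range then ξ ⟨r, hr⟩ else 0 := by
      funext x
      simp only [X, SimpleFunc.map_apply]
      rw [dif_pos (g.mem_range_self x)]
    rw [this]
    exact SimpleFunc.measurable _
  have hμ' : ∑ i, ρ i Set.univ • Measure.dirac (ξ i) = μ.map X := by
    ext s hs
    have h1 : X ⁻¹' s = ⋃ i, A i ∩ X ⁻¹' s := by
      rw [← Set.iUnion_inter, hAU, Set.univ_inter]
    rw [Measure.map_apply hXm hs, Measure.finsetSum_apply, h1, measure_iUnion
      (fun i j hij => (hAd hij).mono Set.inter_subset_left Set.inter_subset_left)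
      (fun i => (hA i).inter (hXm hs)), tsum_fintype]
    refine Finset.sum_congr rfl fun i _ => ?_
    rw [Measure.smul_apply, Measure.dirac_apply' _ hs, hρmass, smul_eq_mul]
    by_cases hi : ξ i ∈ s
    · have : A i ∩ X ⁻¹' s = A i := Set.inter_eq_left.2 fun x hx => by
        rw [Set.mem_preimage, hXA i x hx]; exact hi
      simp [this, hi]
    · have : A i ∩ X ⁻¹' s = ∅ := Set.eq_empty_of_forall_notMem fun x hx => hi <| by
        rw [← hXA i x hx.1]; exact hx.2
      simp [this, hi]
  rw [hμ', hρsum] at hmart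
  have hμ'prob : IsProbabilityMeasure (μ.map X) :=
    Measure.isProbabilityMeasure_map hXm.aemeasurable
  have hμ'K : (μ.map X) (Set.Icc (-K) K)ᶜ = 0 := by
    rw [Measure.map_apply hXm measurableSet_Icc.compl]
    convert measure_empty (μ := μ)
    exact Set.eq_empty_of_forall_notMem fun x hx => hx (abs_le.1 (hξK _))
  have hν'I : (κ ∘ₘ ν) (Set.Icc (-R) R)ᶜ = 0 := comp_apply_eq_zero measurableSet_Icc.compl hκI _
  have hP1μ : IsP1 (μ.map X) := ⟨hμ'prob, integrable_id_of_compl_Icc hμ'K⟩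
  have hP1ν : IsP1 (κ ∘ₘ ν) := ⟨inferInstance, integrable_id_of_compl_Icc hν'I⟩
  have hac : κ ∘ₘ ν ≪ volume := comp_absolutelyContinuous hκac ν
  have hcl : Integrable (fun y => |clip K y - y|) ν := (hclip.sub hνid).abs
  refine ⟨μ.map X, κ ∘ₘ ν, hP1μ, hP1ν, ⟨hmart.convexOrder hP1μ hP1ν, fun S B hS hB hSpos hBpos =>
    ⟨_, hmart, ?_⟩⟩, ?_, ?_, ?_⟩
  -- As `ν'` lives on `[-R, R]` and is absolutely continuous, a set it charges meets the interval in
  -- positive Lebesgue measure, hence is charged by every `κ y`.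
  · have hvol : volume (B ∩ Set.Icc (-R) R) ≠ 0 := fun h0 => hBpos.ne' <| by
      refine le_antisymm ?_ zero_le
      calc (κ ∘ₘ ν) B ≤ (κ ∘ₘ ν) (B ∩ Set.Icc (-R) R) + (κ ∘ₘ ν) (Set.Icc (-R) R)ᶜ := by
            refine (measure_mono fun x hx => ?_).trans (measure_union_le _ _)
            by_cases hxI : x ∈ Set.Icc (-R) R
            · exact Or.inl ⟨hx, hxI⟩
            · exact Or.inr hxI
        _ = 0 := by rw [hac h0, hν'I, add_zero]
    rw [← hμ', Measure.finsetSum_apply] at hSpos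
    obtain ⟨i, -, hi⟩ := Finset.exists_ne_zero_of_sum_ne_zero hSpos.ne'
    rw [Measure.smul_apply, Measure.dirac_apply' _ hS, smul_eq_mul] at hi
    have hiS : ξ i ∈ S := by
      by_contra hn
      simp [hn] at hi
    have hip : N i Set.univ ≠ 0 := by
      rw [hNmass, ← hρmass]
      exact left_ne_zero_of_mul hi
    refine lt_of_lt_of_le ?_ (Measure.le_iff'.1 (Finset.single_le_sum
      (f := fun i => (ρ i).map (Prod.mk (ξ i))) (fun j _ => Measure.zero_le _)
      (Finset.mem_univ i)) _)
    rw [Measure.map_apply measurable_prodMk_left (hS.prod hB), Set.mk_preimage_prod_right hiS]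
    refine lt_of_lt_of_le ?_ (mul_le_comp_apply hB (fun y => hκlow y B hB) (N i))
    exact ENNReal.mul_pos (ENNReal.mul_pos (by simpa using hc) hvol).ne' hip
  · refine regularPair_of_bounds hR hc hac hν'I (fun B hB => ?_) isClosed_Icc
      (fun x hx => ⟨by linarith [hx.1], by linarith [hx.2]⟩) hμ'K
    simpa using mul_le_comp_apply hB (fun y => hκlow y B hB) ν
  · refine (W1_le_of_map hXm).trans ?_
    have hgint : Integrable (fun x => g x) μ := g.integrable_of_isFiniteMeasure
    have hXint : Integrable X μ := Integrable.of_bound hXm.aestronglyMeasurable K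
      (ae_of_all _ fun x => hξK _)
    have hdint : Integrable (fun x => |X x - x|) μ := (hXint.sub hμid).abs
    have hgd : Integrable (fun x => |x - g x|) μ := (hμid.sub hgint).abs
    rw [← ofReal_integral_eq_lintegral_ofReal hdint (ae_of_all _ fun x => abs_nonneg _)]
    refine ENNReal.ofReal_le_ofReal ?_
    have hsplit : ∀ {f : ℝ → ℝ}, Integrable f μ → ∫ x, f x ∂μ = ∑ i, ∫ x in A i, f x ∂μ :=
      fun {f} hf => by
        rw [← setIntegral_univ, ← hAU, integral_iUnion_fintype hA hAd fun i => hf.integrableOn]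
    have hcell : ∀ i, ∫ x in A i, |X x - x| ∂μ ≤
        2 * ∫ x in A i, |x - g x| ∂μ + ∫ y, |clip K y - y| ∂N i := by
      intro i
      have e0 : ∀ x ∈ A i, g x = i := fun x hx => hx
      have e1 : μ.real (A i) * |ξ i - i| ≤
          ∫ x in A i, |x - g x| ∂μ + ∫ y, |clip K y - y| ∂N i := by
        -- The first moments of `N i` and of `μ` on `A i` agree and cancel, leaving only the
        -- discretization and truncation errors.
        have e2 : μ.real (A i) * (ξ i - i) =
            ∫ x in A i, (x - g x) ∂μ + ∫ y, (clip K y - y) ∂N i := by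
          rw [integral_sub hμid.integrableOn hgint.integrableOn,
            integral_sub hclip (hνid.mono_measure (hNle i)), hξ, hNmean,
            setIntegral_congr_fun (hA i) e0, setIntegral_const, smul_eq_mul]
          ring
        rw [← abs_of_nonneg (measureReal_nonneg (μ := μ) (s := A i)), ← abs_mul, e2]
        exact (abs_add_le _ _).trans (add_le_add abs_integral_le_integral_abs
          abs_integral_le_integral_abs)
      have e3 : ∫ x in A i, |X x - x| ∂μ ≤ ∫ x in A i, (|ξ i - i| + |x - g x|) ∂μ := by
        refine setIntegral_mono_on hdint.integrableOn
          ((integrable_const _).add hgd.integrableOn) (hA i) fun x hx => ?_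
        rw [hXA i x hx, e0 x hx, abs_sub_comm x]
        exact abs_sub_le _ _ _
      rw [integral_add (integrable_const _) hgd.integrableOn, setIntegral_const, smul_eq_mul] at e3
      linarith
    have hNs : ∑ i, ∫ y, |clip K y - y| ∂N i = ∫ y, |clip K y - y| ∂ν := by
      rw [← integral_finsetSum_measure fun i _ => hcl.mono_measure (hNle i), hNsum]
    rw [hsplit hdint]
    refine (Finset.sum_le_sum fun i _ => hcell i).trans ?_
    rw [Finset.sum_add_distrib, ← Finset.mul_sum, ← hsplit hgd, hNs]
    -- The discretization error enters twice and the truncation error once, each at most `ε`.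
    linarith
  · refine (W1_comp_le κ).trans ((lintegral_mono hκdist).trans ?_)
    rw [← ofReal_integral_eq_lintegral_ofReal (f := fun y => |clip K y - y| + 2 * ε)
      (hcl.add (integrable_const _)) (ae_of_all _ fun y => by positivity), integral_add hcl (integrable_const _)]
    refine ENNReal.ofReal_le_ofReal ?_
    simp only [integral_const, probReal_univ, one_smul]
    linarith

end Approximation

end BassApprox

theorem lemmaA1 (μ ν : Measure ℝ) (hμ : BassApprox.IsP1 μ) (hν : BassApprox.IsP1 ν)
    (hμν : BassApprox.ConvexOrder μ ν) :
    ∃ μs νs : ℕ → Measure ℝ,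
      (∀ n, BassApprox.IsP1 (μs n) ∧ BassApprox.IsP1 (νs n) ∧
        BassApprox.Irreducible (μs n) (νs n) ∧ BassApprox.RegularPair (μs n) (νs n)) ∧
      Tendsto (fun n => BassApprox.W1 (μs n) μ) atTop (𝓝 0) ∧
      Tendsto (fun n => BassApprox.W1 (νs n) ν) atTop (𝓝 0) := by
  have hpos : ∀ n : ℕ, (0 : ℝ) < 1 / ((n : ℝ) + 1) := fun n => by positivity
  have hle : ∀ n : ℕ, 1 / ((n : ℝ) + 1) ≤ 1 := fun n => by
    rw [div_le_one (by positivity)]; linarith [Nat.cast_nonneg (α := ℝ) n]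
  choose μs νs h1 h2 h3 h4 h5 h6 using fun n : ℕ => hμν.exists_regular_approx (hpos n) (hle n)
  have hlim : Tendsto (fun n : ℕ => ENNReal.ofReal (3 * (1 / ((n : ℝ) + 1)))) atTop (𝓝 0) := by
    have := ENNReal.tendsto_ofReal
      ((tendsto_one_div_add_atTop_nhds_zero_nat (𝕜 := ℝ)).const_mul 3)
    simpa using this
  exact ⟨μs, νs, fun n => ⟨h1 n, h2 n, h3 n, h4 n⟩,
    tendsto_of_tendsto_of_tendsto_of_le_of_le tendsto_const_nhds hlim (fun _ => zero_le) h5,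
    tendsto_of_tendsto_of_tendsto_of_le_of_le tendsto_const_nhds hlim (fun _ => zero_le) h6⟩
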